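/- Setting. $L\ge 1$ transmitters serve $K$ users through a linear network over $\mathbb F_q$, $q=2^m$: in each channel use the transmitters send $\mathbf s\in\mathbb F_q^L$ and user $k$ receives the $k$-th entry of $\mathbf r=\mathbf H\mathbf s$, where $\mathbf H\in\mathbb F_q^{K\times L}$ (rows $\mathbf h_k$) is uniformly random and fixed during the delivery. There are $N\ge 1$ files $W_1,\dots,W_N$ of $F$ bits; words of $m$ bits are identified with elements of $\mathbb F_q$. Let $0\le M\le N$. Algorithm. Placement: for each file, each user stores a uniformly random set of $\lfloor\frac MN F\rfloor$ of its $F$ bits, independently over users and files. For $S\subseteq[K]$ let $W_{n,S}$ be the bits of file $n$ stored by exactly the users in $S$. Delivery for demands $d_1,\dots,d_K\in[N]$: for each $\alpha=K,\dots,1$, put $t=\min(\alpha+L-1,K)$ and divide each $W_{n,S}$ with $|S|=\alpha-1$ as evenly as possible into $\binom{K-\alpha}{t-\alpha}$ mini-files. For each $\mathcal T\subseteq[K]$ with $|\mathcal T|=t$ and each $\omega=1,\dots,\binom{t-1}{\alpha-1}$ the vectors $$\sum_{\mathcal U\subseteq\mathcal T,\ |\mathcal U|=\alpha} G_\omega(\mathcal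 U)\,\boldsymbol\psi^{\mathcal T\setminus\mathcal U},\qquad G_\omega(\mathcal U)=\sum_{r\in\mathcal U}\varphi^{(\omega)}_{r}\,W^{c}_{d_r,\mathcal U\setminus\{r\}},$$ are sent, where $W^{c}_{d_r,\mathcal U\setminus\{r\}}$ is the next mini-file of $W_{d_r,\mathcal U\setminus\{r\}}$ not yet used for $\mathcal U$, written as a sequence of symbols of $\mathbb F_q$ and filled up with zero bits to the longest length occurring for $(\alpha,\mathcal T)$; the coefficients $\varphi^{(\omega)}_{r}\in\mathbb F_q$ are drawn independently and uniformly for each $\alpha,\mathcal T,\omega,\mathcal U,r$; and $\boldsymbol\psi^{\mathcal T\setminus\mathcal U}\in\mathbb F_q^L$ are zero-forcing vectors: $\mathbf h_i\cdot\boldsymbol\psi^{\mathcal T\setminus\mathcal U}=0$ for $i\in\mathcal T\setminus\mathcal U$ and $\ne 0$ for $i\in\mathcal U$. The coding delay is the number of channel uses for the worst demand, measured in units of the $F/m$ symbols of a file. Claim. Let $$T_C=\sum_{\alpha=1}^{K}\binom K\alpha\Big(\frac MN\Big)^{\alpha-1}\Big(1-\frac MN\Big)^{K-\alpha+1}\frac{\alpha}{\min(\alpha+L-1,K)}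 .$$ For every $\delta>0$ there is $m_0$, depending only on $K,L,\delta$, such that for all $m\ge m_0$, all $N\ge1$ and all $0\le M\le N$, with probability at least $1-\delta$ over $\mathbf H$ and the coefficients, zero-forcing vectors exist and for every choice of them the following holds: for every $\varepsilon>0$, the probability over the placement that, for all demands, every user recovers the file it requested (for every content of the library) and that the coding delay is within $\varepsilon$ of $T_C$ tends to $1$ as $F\to\infty$. Moreover, for $L=1$ and $0<M\le N$, $T_C$ equals the Maddah-Ali–Niesen decentralized delay $K\big(1-\frac MN\big)\frac{N}{KM}\Big(1-\big(1-\frac MN\big)^K\Big)$. -/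

import Mathlib

open Filter Topology

namespace CodedCaching

/-- The probability of an event under the uniform distribution on a finite sample space. On a
product of finite spaces this is the law of independent, uniformly distributed coordinates. -/
noncomputable def uniformProb {Ω : Type*} (A : Set Ω) : ℝ :=
  letI : MeasurableSpace Ω := ⊤
  (ProbabilityTheory.uniformOn (Set.univ : Set Ω) A).toReal

/-! ### Placement -/

/-- The library: `N` files of `F` bits each. -/
abbrev Library (N F : ℕ) : Type := Fin N → Fin F → Bool

/-- A placement: for every user and every file, a set of `c` bit positions of that file, which the
user stores. The uniform law on placements is the one in which the users choose these sets
independently and uniformly at random. -/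
abbrev Placement (K N F c : ℕ) : Type :=
  Fin K → Fin N → {s : Finset (Fin F) // s.card = c}

/-- The number of bits of each file that a user stores, `(M / N) F` (rounded down). -/
noncomputable def cachedBits (N : ℕ) (M : ℝ) (F : ℕ) : ℕ := ⌊M / N * F⌋₊

/-- What user `k` has in its cache when the library is `W`. -/
def cacheContent {K N F c : ℕ} (Z : Placement K N F c) (W : Library N F) (k : Fin K) :
    (n : Fin N) → {b : Fin F // b ∈ (Z k n).1} → Bool :=
  fun n b => W n b.1

/-- The positions of the subfile `W_{n,S}`: those bits of file `n` which are stored by every user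
in `S` and by no other user. -/
def subfile {K N F c : ℕ} (Z : Placement K N F c) (n : Fin N) (S : Finset (Fin K)) :
    Finset (Fin F) :=
  Finset.univ.filter fun b => ∀ k, b ∈ (Z k n).1 ↔ k ∈ S

/-! ### Mini-files -/

/-- `min (α + L - 1, K)`, the number of users served by one transmission of order `α`. -/
def groupSize (K L α : ℕ) : ℕ := min (α + L - 1) K

/-- The number of transmissions (with different coefficients) made for one group of users. -/
def numRepeats (K L α : ℕ) : ℕ := (groupSize K L α - 1).choose (α - 1)

/-- The number of mini-files into which a subfile `W_{n,S}`, `|S| = α - 1`, is divided. -/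
def numMini (K L α : ℕ) : ℕ := (K - α).choose (groupSize K L α - α)

/-- The counter `c_U`: the number (starting at `0`) of the mini-file that is used for `U` when the
group `T` is served, that is, the number of groups of the same size containing `U` that have been
served before `T`. The groups are served in colexicographic order. -/
def miniIndex {K : ℕ} (T U : Finset (Fin K)) : ℕ :=
  ((Finset.powersetCard T.card Finset.univ).filter
    fun T' : Finset (Fin K) => U ⊆ T' ∧ toColex T' < toColex T).card

/-- The length in bits of mini-file number `j` of `a` mini-files of `W_{n,S}`: it consists of
the bits of the subfile whose rank in the subfile is congruent to `j` modulo `a`. -/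
def miniBits {K N F c : ℕ} (Z : Placement K N F c) (n : Fin N) (S : Finset (Fin K)) (a j : ℕ) :
    ℕ :=
  ((Finset.range (subfile Z n S).card).filter fun i => i % a = j).card

/-- The bits `l = 0, …, m - 1` of symbol number `p` of mini-file number `j` of `a` mini-files of
`W_{n,S}`, filled up with zeros beyond the end of the mini-file. -/
def miniWord {K N F c : ℕ} (m : ℕ) (Z : Placement K N F c) (W : Library N F) (n : Fin N)
    (S : Finset (Fin K)) (a j p : ℕ) : Fin m → Bool :=
  fun l =>
    if h : j + a * (m * p + l) < ((subfile Z n S).sort (· ≤ ·)).length then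
      W n (((subfile Z n S).sort (· ≤ ·))[j + a * (m * p + l)])
    else false

/-! ### Delivery -/

/-- The values `1, …, K` of the multicasting order `α`. -/
abbrev Order (K : ℕ) : Type := {α : ℕ // α ∈ Finset.Icc 1 K}

/-- The groups `T` of `min (α + L - 1, K)` users. -/
abbrev Group (K L α : ℕ) : Type := {T : Finset (Fin K) // T.card = groupSize K L α}

/-- The number of `m`-bit symbols of one transmission to the group `T`: the largest number of
symbols in a mini-file that takes part in it. -/
def blockLength {K N F c : ℕ} (L m : ℕ) (Z : Placement K N F c) (d : Fin K → Fin N) (α : ℕ)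
    (T : Finset (Fin K)) : ℕ :=
  (Finset.powersetCard α T).sup fun U => U.sup fun r =>
    miniBits Z (d r) (U \ {r}) (numMini K L α) (miniIndex T U) ⌈/⌉ m

/-- The channel uses of the delivery phase for the demand `d`: for every `α`, every group `T` and
every repetition `ω`, one channel use for each symbol of the block. -/
abbrev ChannelUse {K N F c : ℕ} (L m : ℕ) (Z : Placement K N F c) (d : Fin K → Fin N) : Type :=
  (α : Order K) × (T : Group K L α) × Fin (numRepeats K L α) × Fin (blockLength L m Z d α T)

/-- The coding delay, in channel uses: the number of channel uses for the worst demand. -/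
def codingDelay {K N F c : ℕ} (L m : ℕ) (Z : Placement K N F c) : ℕ :=
  Finset.univ.sup fun d : Fin K → Fin N => Fintype.card (ChannelUse L m Z d)

/-- The coefficients of the random linear combinations `φ^(ω)`, for every `α`, `T`, `ω`, and
every `U` and `r` (only those with `r ∈ U ⊆ T` and `|U| = α` are used). -/
abbrev Coefficients (𝔽 : Type) (K L : ℕ) : Type :=
  (α : Order K) → Group K L α → Fin (numRepeats K L α) → Finset (Fin K) → Fin K → 𝔽

/-- `ψ` is a zero-forcing design for the channel `H`: for every `U ⊆ T` occurring in the delivery,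
`ψ (T \ U)` is orthogonal to the channel vectors of the users in `T \ U`, so that these
users do not hear it, and is not orthogonal to the channel vectors of the users in `U`. -/
def IsZeroForcing {𝔽 : Type} [Field 𝔽] {K L : ℕ} (H : Matrix (Fin K) (Fin L) 𝔽)
    (ψ : Finset (Fin K) → Fin L → 𝔽) : Prop :=
  ∀ (α : Order K) (T : Group K L α), ∀ U ∈ Finset.powersetCard α.1 T.1,
    (∀ i ∈ T.1 \ U, H i ⬝ᵥ ψ (T.1 \ U) = 0) ∧ ∀ i ∈ U, H i ⬝ᵥ ψ (T.1 \ U) ≠ 0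

/-- The vector `s = ∑_U G_ω(U) ψ^{T \ U}` sent by the `L` transmitters in a channel use, where
`G_ω(U)` is the linear combination, over `r ∈ U`, of the current symbols of the mini-files
of `W_{d_r, U \ {r}}`. Words of `m` bits are identified with elements of the field by `e`. -/
def sent {𝔽 : Type} [Field 𝔽] {K L N F c m : ℕ} (e : (Fin m → Bool) ≃ 𝔽)
    (φ : Coefficients 𝔽 K L) (ψ : Finset (Fin K) → Fin L → 𝔽) (Z : Placement K N F c)
    (W : Library N F) (d : Fin K → Fin N) : ChannelUse L m Z d → Fin L → 𝔽 :=
  fun ⟨α, T, ω, p⟩ =>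
    ∑ U ∈ Finset.powersetCard α.1 T.1,
      (∑ r ∈ U, φ α T ω U r *
        e (miniWord m Z W (d r) (U \ {r}) (numMini K L α) (miniIndex T.1 U) p)) • ψ (T.1 \ U)

/-- The symbol received by user `k`: component `k` of `H s`. -/
def received {𝔽 : Type} [Field 𝔽] {K L N F c m : ℕ} (e : (Fin m → Bool) ≃ 𝔽)
    (H : Matrix (Fin K) (Fin L) 𝔽) (φ : Coefficients 𝔽 K L) (ψ : Finset (Fin K) → Fin L → 𝔽)
    (Z : Placement K N F c) (W : Library N F) (d : Fin K → Fin N) (k : Fin K) :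
    ChannelUse L m Z d → 𝔽 :=
  fun x => H.mulVec (sent e φ ψ Z W d x) k

/-- For every demand, every user can recover the file it asks for, whatever the library is, from
the symbols it receives and the content of its cache (the placement, the demand, the channel,
the coefficients and the zero-forcing vectors being known). -/
def AllDecode {𝔽 : Type} [Field 𝔽] {K L N F c m : ℕ} (e : (Fin m → Bool) ≃ 𝔽)
    (H : Matrix (Fin K) (Fin L) 𝔽) (φ : Coefficients 𝔽 K L) (ψ : Finset (Fin K) → Fin L → 𝔽)
    (Z : Placement K N F c) : Prop :=
  ∀ (d : Fin K → Fin N) (k : Fin K),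
    ∃ decode : (ChannelUse L m Z d → 𝔽) →
        ((n : Fin N) → {b : Fin F // b ∈ (Z k n).1} → Bool) → Fin F → Bool,
      ∀ W : Library N F, decode (received e H φ ψ Z W d k) (cacheContent Z W k) = W (d k)

/-- With the channel `H`, the coefficients `φ` and the zero-forcing vectors `ψ`, the algorithm
achieves the coding delay `τ` with high probability as the file size `F` tends to infinity:
the probability (over the placement) that all users decode for all demands and that the coding
delay, measured in units of the `F / m` symbols of a file, is within `ε` of `τ` tends to `1`. -/
def Achieves {𝔽 : Type} [Field 𝔽] {K L m : ℕ} (N : ℕ) (M : ℝ) (e : (Fin m → Bool) ≃ 𝔽)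
    (H : Matrix (Fin K) (Fin L) 𝔽) (φ : Coefficients 𝔽 K L) (ψ : Finset (Fin K) → Fin L → 𝔽)
    (τ : ℝ) : Prop :=
  ∀ ε : ℝ, 0 < ε →
    Tendsto (fun F : ℕ => uniformProb {Z : Placement K N F (cachedBits N M F) |
      AllDecode e H φ ψ Z ∧ |(codingDelay L m Z : ℝ) / ((F : ℝ) / m) - τ| ≤ ε}) atTop (𝓝 1)

/-- The coding delay
`∑_{α=1}^K C(K,α) (M/N)^{α-1} (1-M/N)^{K-α+1} α / min (α+L-1, K)`. -/
noncomputable def delay (K L N : ℕ) (M : ℝ) : ℝ :=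
  ∑ α ∈ Finset.Icc 1 K, (K.choose α : ℝ) * (M / N) ^ (α - 1) * (1 - M / N) ^ (K - α + 1) *
    ((α : ℝ) / (min (α + L - 1) K : ℕ))

end CodedCaching

/-! Decodability and delay separate. Decoding works for every placement once `ψ` is zero-forcing and
`φ` satisfies `IsGeneric` (`allDecode`). Fix a group `T` and a user `k` in it. Zero-forcing silences
every `U` not containing `k`. In the remaining `G_ω(U)`, each term with `r ≠ k` belongs to a subfile
that `k` has cached, so `k` can subtract it. What is left over the repetitions `ω` is a linear
system in one wanted symbol per `U ∋ k`; its matrix is the coefficient matrix with columns scaled by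
nonzero gains, so the solution is unique (`miniWord_eq_of_received_eq`). As `T` runs over the groups
containing `U`, the counter runs through all mini-files (`exists_miniIndex_eq`), so no bit is
missed.

The two conditions fail only if one of finitely many vectors falls into the span of too few
independent others. Each such event has probability at most `1/q`, and their number depends on `K`
and `L` alone (`le_uniformProb_good`). Outside these events a zero-forcing vector exists because
fewer than `q` proper subspaces cannot cover a space.

For the delay, storing distinct bits is negatively correlated, so Chebyshev's inequality
concentrates every subfile size (`tendsto_uniformProb_subfile`). Padding, rounding and the maximum
over demands cost only lower-order terms, and a binomial identity (`choose_mul_choose_div`) turns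
the number of transmissions into the weights of `delay`. -/

namespace CodedCaching

/-! ### Uniform probability on finite spaces: union bound, resampling, Chebyshev. -/

section Probability

variable {Ω : Type*}

lemma uniformProb_eq_card_div [Finite Ω] (A : Set Ω) :
    uniformProb A = (Nat.card A : ℝ) / Nat.card Ω := by
  classical
  have := Fintype.ofFinite Ω
  let _ : MeasurableSpace Ω := ⊤
  have : MeasurableSingletonClass Ω := ⟨fun _ => trivial⟩
  have h : uniformProb A = (ProbabilityTheory.uniformOn (Set.univ : Set Ω) A).toReal := rfl
  rw [h, ProbabilityTheory.uniformOn_univ,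
    MeasureTheory.Measure.count_apply_finite A (Set.toFinite A)]
  simp [ENNReal.toReal_div, Nat.card_eq_fintype_card, Set.toFinite_toFinset, Set.toFinset_card]

open Classical in
lemma uniformProb_mul_card [Fintype Ω] (A : Set Ω) :
    uniformProb A * Fintype.card Ω = ∑ ω, if ω ∈ A then (1 : ℝ) else 0 := by
  rw [uniformProb_eq_card_div, Nat.card_eq_fintype_card, Nat.card_eq_fintype_card]
  rcases isEmpty_or_nonempty Ω with h | h
  · simp
  · rw [div_mul_cancel₀ _ (by exact_mod_cast Fintype.card_ne_zero)]
    simp [Fintype.card_subtype]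

lemma uniformProb_nonneg (A : Set Ω) : 0 ≤ uniformProb A := ENNReal.toReal_nonneg

lemma uniformProb_mono [Finite Ω] {A B : Set Ω} (h : A ⊆ B) :
    uniformProb A ≤ uniformProb B := by
  rw [uniformProb_eq_card_div, uniformProb_eq_card_div]
  gcongr
  exact Nat.card_mono (Set.toFinite B) h

lemma uniformProb_univ [Finite Ω] [Nonempty Ω] : uniformProb (Set.univ : Set Ω) = 1 := by
  rw [uniformProb_eq_card_div]
  have : (Nat.card Ω : ℝ) ≠ 0 := by exact_mod_cast Nat.card_pos.ne'
  simp [this]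

lemma uniformProb_le_one [Finite Ω] (A : Set Ω) : uniformProb A ≤ 1 := by
  rcases isEmpty_or_nonempty Ω with h | h
  · rw [uniformProb_eq_card_div]; simp
  · exact (uniformProb_mono (Set.subset_univ A)).trans uniformProb_univ.le

lemma uniformProb_compl [Finite Ω] [Nonempty Ω] (A : Set Ω) :
    uniformProb Aᶜ = 1 - uniformProb A := by
  classical
  have := Fintype.ofFinite Ω
  have hc : (Fintype.card Ω : ℝ) ≠ 0 := by exact_mod_cast Fintype.card_ne_zero
  apply mul_right_cancel₀ hc
  rw [sub_mul, uniformProb_mul_card, uniformProb_mul_card, eq_sub_iff_add_eq,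
    ← Finset.sum_add_distrib]
  rw [Finset.sum_congr rfl (g := fun _ => (1 : ℝ))]
  · simp
  · intro ω _
    by_cases h : ω ∈ A <;> simp [h]

lemma uniformProb_iUnion_le [Finite Ω] {ι : Type*} [Fintype ι] (A : ι → Set Ω) :
    uniformProb (⋃ i, A i) ≤ ∑ i, uniformProb (A i) := by
  classical
  have := Fintype.ofFinite Ω
  rcases isEmpty_or_nonempty Ω with h | h
  · simp [uniformProb_eq_card_div]
  have hc : (0 : ℝ) < Fintype.card Ω := by exact_mod_cast Fintype.card_pos
  apply le_of_mul_le_mul_right _ hc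
  rw [Finset.sum_mul]
  simp_rw [uniformProb_mul_card]
  rw [Finset.sum_comm]
  refine Finset.sum_le_sum fun ω _ => ?_
  split_ifs with hω
  · obtain ⟨i, hi⟩ := Set.mem_iUnion.1 hω
    refine le_trans (by simp [hi]) (Finset.single_le_sum (f := fun i => if ω ∈ A i then (1:ℝ) else 0)
      (fun i _ => by positivity) (Finset.mem_univ i))
  · exact Finset.sum_nonneg fun i _ => by positivity

/-- If none of finitely many events, each of probability at most `c`, forces `A`, then `A` has
probability at least `1 - n c`. -/
lemma one_sub_le_uniformProb [Finite Ω] [Nonempty Ω] {ι : Type*} [Fintype ι] {A : Set Ω}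
    {B : ι → Set Ω} {c : ℝ} (hB : ∀ i, uniformProb (B i) ≤ c)
    (hA : ∀ ω, (∀ i, ω ∉ B i) → ω ∈ A) :
    1 - Fintype.card ι * c ≤ uniformProb A := by
  have h1 : (⋃ i, B i)ᶜ ⊆ A := fun ω hω => hA ω (by simpa using hω)
  have h2 := uniformProb_mono h1
  have h3 : ∑ i, uniformProb (B i) ≤ Fintype.card ι * c := by
    refine (Finset.sum_le_sum fun i _ => hB i).trans (by simp)
  have h4 := uniformProb_iUnion_le B
  rw [uniformProb_compl] at h2
  linarith

lemma uniformProb_pi {ι : Type*} [Fintype ι] {X : ι → Type*} [∀ i, Finite (X i)]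
    (A : ∀ i, Set (X i)) :
    uniformProb {f : ∀ i, X i | ∀ i, f i ∈ A i} = ∏ i, uniformProb (A i) := by
  classical
  have := fun i => Fintype.ofFinite (X i)
  simp_rw [uniformProb_eq_card_div]
  rw [Finset.prod_div_distrib, Nat.card_pi]
  have e : {f : ∀ i, X i | ∀ i, f i ∈ A i} ≃ ∀ i, A i :=
    { toFun := fun f i => ⟨f.1 i, f.2 i⟩
      invFun := fun g => ⟨fun i => (g i).1, fun i => (g i).2⟩
      left_inv := fun _ => rfl
      right_inv := fun _ => rfl }
  rw [Nat.card_congr e, Nat.card_pi]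
  push_cast
  rfl

lemma uniformProb_pi_coord {ι : Type*} [Fintype ι] {X : Type*} [Finite X] [Nonempty X]
    (i : ι) (A : Set X) : uniformProb {f : ι → X | f i ∈ A} = uniformProb A := by
  classical
  have h := uniformProb_pi (X := fun _ : ι => X) (fun j => if j = i then A else Set.univ)
  have h1 : {f : ι → X | ∀ j, f j ∈ (if j = i then A else Set.univ)} = {f : ι → X | f i ∈ A} := by
    ext f
    simp only [Set.mem_ofPred_eq]
    refine ⟨fun hf => by simpa using hf i, fun hf j => ?_⟩
    by_cases hj : j = i
    · subst hj; simpa using hf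
    · simp [hj]
  rw [h1] at h
  rw [h]
  have h2 : ∀ j, uniformProb (if j = i then A else Set.univ) = if j = i then uniformProb A else 1 := by
    intro j
    split_ifs
    · rfl
    · exact uniformProb_univ
  simp_rw [h2]
  simp

/-- Resampling a uniformly distributed coordinate `r` (with update map `u`): if every section of
`A` along this coordinate has at most `c` elements, then `A` has density at most `c / |V|`. -/
lemma uniformProb_le_of_resample [Finite Ω] {V : Type*} [Finite V] [Nonempty V] (u : Ω → V → Ω)
    (r : Ω → V) (huu : ∀ ω v w, u (u ω v) w = u ω w) (hru : ∀ ω v, r (u ω v) = v)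
    (hur : ∀ ω, u ω (r ω) = ω) (A : Set Ω) (c : ℕ)
    (hA : ∀ ω, Nat.card {v | u ω v ∈ A} ≤ c) :
    uniformProb A ≤ c / Nat.card V := by
  classical
  have := Fintype.ofFinite Ω
  have := Fintype.ofFinite V
  have key : Nat.card A * Nat.card V ≤ c * Nat.card Ω := by
    -- Exchanging the current coordinate `r ω` with the fresh value `v` is an involution of `Ω × V`;
    -- it carries one set onto the other, and the second can be counted section by section.
    have e : {x : Ω × V | x.1 ∈ A} ≃ {x : Ω × V | u x.1 x.2 ∈ A} :=
      { toFun := fun x => ⟨(u x.1.1 x.1.2, r x.1.1), by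
          change u (u x.1.1 x.1.2) (r x.1.1) ∈ A
          rw [huu, hur]
          exact x.2⟩
        invFun := fun x => ⟨(u x.1.1 x.1.2, r x.1.1), x.2⟩
        left_inv := fun x => by ext <;> simp [huu, hru, hur]
        right_inv := fun x => by ext <;> simp [huu, hru, hur] }
    have e1 : {x : Ω × V | x.1 ∈ A} ≃ A × V :=
      { toFun := fun x => (⟨x.1.1, x.2⟩, x.1.2)
        invFun := fun x => ⟨(x.1.1, x.2), x.1.2⟩
        left_inv := fun _ => rfl
        right_inv := fun _ => rfl }
    have e2 : {x : Ω × V | u x.1 x.2 ∈ A} ≃ Σ ω : Ω, {v | u ω v ∈ A} :=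
      { toFun := fun x => ⟨x.1.1, x.1.2, x.2⟩
        invFun := fun x => ⟨(x.1, x.2.1), x.2.2⟩
        left_inv := fun _ => rfl
        right_inv := fun _ => rfl }
    rw [← Nat.card_prod, ← Nat.card_congr e1, Nat.card_congr e, Nat.card_congr e2, Nat.card_sigma]
    refine (Finset.sum_le_sum fun ω _ => hA ω).trans ?_
    simp [mul_comm]
  rw [uniformProb_eq_card_div]
  rcases isEmpty_or_nonempty Ω with h | h
  · simp; positivity
  rw [div_le_div_iff₀ (by exact_mod_cast Nat.card_pos) (by exact_mod_cast Nat.card_pos)]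
  exact_mod_cast key

/-- A uniformly distributed vector of `𝔽^ι` lies in the span of fewer than `|ι|` vectors, which
do not depend on it, with probability at most `1 / |𝔽|`. -/
lemma uniformProb_mem_span_le [Finite Ω] {𝔽 : Type*} [Field 𝔽] [Finite 𝔽] {ι J : Type*} [Fintype ι]
    [Fintype J] (u : Ω → (ι → 𝔽) → Ω) (r : Ω → ι → 𝔽) (huu : ∀ ω v w, u (u ω v) w = u ω w)
    (hru : ∀ ω v, r (u ω v) = v) (hur : ∀ ω, u ω (r ω) = ω) (x : Ω → J → ι → 𝔽)
    (hx : ∀ ω v, x (u ω v) = x ω) (hJ : Fintype.card J < Fintype.card ι) :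
    uniformProb {ω | r ω ∈ Submodule.span 𝔽 (Set.range (x ω))} ≤ 1 / Nat.card 𝔽 := by
  classical
  have := Fintype.ofFinite 𝔽
  have hq : 0 < Nat.card 𝔽 := Nat.card_pos
  -- The span does not move under resampling and has dimension at most `|J|`, hence at most `q ^
  -- |J|` elements.
  refine (uniformProb_le_of_resample u r huu hru hur _ (Nat.card 𝔽 ^ Fintype.card J) ?_).trans ?_
  · intro ω
    simp only [Set.mem_ofPred_eq, hru, hx]
    change Nat.card (Submodule.span 𝔽 (Set.range (x ω))) ≤ _
    rw [Module.natCard_eq_pow_finrank (K := 𝔽)]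
    exact Nat.pow_le_pow_right hq (finrank_range_le_card (x ω))
  · have : Nat.card (ι → 𝔽) = Nat.card 𝔽 ^ Fintype.card ι := by simp
    rw [this, div_le_div_iff₀ (by positivity) (by exact_mod_cast hq)]
    rw [one_mul]
    exact_mod_cast (by
      rw [← pow_succ]
      exact Nat.pow_le_pow_right hq hJ :
        Nat.card 𝔽 ^ Fintype.card J * Nat.card 𝔽 ≤ Nat.card 𝔽 ^ Fintype.card ι)

open Classical in
/-- Chebyshev's inequality for the number of occurring events among equally likely events which
are pairwise not positively correlated. -/
lemma uniformProb_card_deviation_le [Fintype Ω] {ι : Type*} [Fintype ι] (A : ι → Set Ω) {μ : ℝ}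
    (h1 : ∀ b, uniformProb (A b) = μ) (h2 : ∀ b b', b ≠ b' → uniformProb (A b ∩ A b') ≤ μ ^ 2)
    {η : ℝ} (hη : 0 < η) [Nonempty ι] :
    uniformProb {ω | η * Fintype.card ι <
      |((Finset.univ.filter fun b => ω ∈ A b).card : ℝ) - Fintype.card ι * μ|} ≤
      1 / (η ^ 2 * Fintype.card ι) := by
  set n : ℝ := (Fintype.card ι : ℝ) with hn
  have hn0 : 0 < n := by rw [hn]; exact_mod_cast Fintype.card_pos
  rcases isEmpty_or_nonempty Ω with h | h
  · rw [uniformProb_eq_card_div]; simp; positivity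
  set Q : ℝ := (Fintype.card Ω : ℝ) with hQ
  have hQ0 : 0 < Q := by rw [hQ]; exact_mod_cast Fintype.card_pos
  set X : Ω → ℝ := fun ω => ((Finset.univ.filter fun b => ω ∈ A b).card : ℝ) with hX
  have hXe : ∀ ω, X ω = ∑ b, if ω ∈ A b then (1 : ℝ) else 0 := by
    intro ω; simp [hX]
  obtain ⟨b₀⟩ := ‹Nonempty ι›
  have hμ0 : 0 ≤ μ := h1 b₀ ▸ uniformProb_nonneg _
  have hμ1 : μ ≤ 1 := h1 b₀ ▸ uniformProb_le_one _
  have hsum : ∑ ω, X ω = n * μ * Q := by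
    simp_rw [hXe]
    rw [Finset.sum_comm]
    simp_rw [← uniformProb_mul_card, h1]
    simp [n, Q]; ring
  have hsq : ∑ ω, X ω ^ 2 ≤ (n * μ + n ^ 2 * μ ^ 2) * Q := by
    have : ∀ ω, X ω ^ 2 = ∑ b, ∑ b', if ω ∈ A b ∩ A b' then (1 : ℝ) else 0 := by
      intro ω
      rw [hXe, sq, Finset.sum_mul_sum]
      refine Finset.sum_congr rfl fun b _ => Finset.sum_congr rfl fun b' _ => ?_
      by_cases hb : ω ∈ A b <;> by_cases hb' : ω ∈ A b' <;> simp [hb, hb']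
    simp_rw [this]
    rw [Finset.sum_comm]
    have hrow : ∀ b, ∑ ω, ∑ b', (if ω ∈ A b ∩ A b' then (1 : ℝ) else 0) ≤ (μ + n * μ ^ 2) * Q := by
      intro b
      rw [Finset.sum_comm]
      have hu : ∀ b', ∑ ω, (if ω ∈ A b ∩ A b' then (1 : ℝ) else 0) =
          uniformProb (A b ∩ A b') * Q := fun b' => by
        rw [uniformProb_mul_card]
        congr!
      simp_rw [hu]
      rw [← Finset.sum_mul]
      refine mul_le_mul_of_nonneg_right ?_ hQ0.le
      have : ∀ b', uniformProb (A b ∩ A b') ≤ (if b = b' then μ else 0) + μ ^ 2 := by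
        intro b'
        by_cases hb : b = b'
        · subst hb; simp [h1]; positivity
        · simpa [hb] using h2 b b' hb
      refine (Finset.sum_le_sum fun b' _ => this b').trans ?_
      rw [Finset.sum_add_distrib]
      simp [n]
    refine (Finset.sum_le_sum fun b _ => hrow b).trans (le_of_eq ?_)
    simp [n]; ring
  -- The moments give variance at most `n μ`; `μ ≤ 1` removes the dependence on `μ`.
  have hvar : ∑ ω, (X ω - n * μ) ^ 2 ≤ n * Q := by
    have : ∑ ω, (X ω - n * μ) ^ 2 = ∑ ω, X ω ^ 2 - 2 * (n * μ) * ∑ ω, X ω + (n * μ) ^ 2 * Q := by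
      rw [Finset.mul_sum, ← Finset.sum_sub_distrib]
      have : (n * μ) ^ 2 * Q = ∑ _ω : Ω, (n * μ) ^ 2 := by simp [Q]; ring
      rw [this, ← Finset.sum_add_distrib]
      exact Finset.sum_congr rfl fun ω _ => by ring
    rw [this, hsum]
    nlinarith [mul_nonneg (mul_nonneg hn0.le hQ0.le) (sub_nonneg.2 hμ1)]
  rw [le_div_iff₀ (by positivity)]
  have hfin : uniformProb {ω | η * n < |X ω - n * μ|} * Q * (η * n) ^ 2 ≤ n * Q := by
    rw [uniformProb_mul_card, Finset.sum_mul]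
    refine (Finset.sum_le_sum fun ω _ => ?_).trans hvar
    split_ifs with hω
    · rw [one_mul, ← sq_abs (X ω - n * μ)]
      exact pow_le_pow_left₀ (by positivity) (le_of_lt hω) 2
    · rw [zero_mul]; positivity
  have : (uniformProb {ω | η * n < |X ω - n * μ|} * (η ^ 2 * n)) * (n * Q) ≤ 1 * (n * Q) := by
    calc _ = uniformProb {ω | η * n < |X ω - n * μ|} * Q * (η * n) ^ 2 := by ring
      _ ≤ _ := by rw [one_mul]; exact hfin
  exact le_of_mul_le_mul_right this (by positivity)

end Probability

/-! ### Concentration of the subfile sizes under random placement. -/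

section Concentration

/-- The probability that a uniformly random `c`-subset of an `F`-set avoids a given set of size
`a`. -/
lemma uniformProb_disjoint {F c : ℕ} (B : Finset (Fin F)) :
    uniformProb {s : {s : Finset (Fin F) // s.card = c} | Disjoint s.1 B} =
      ((F - B.card).choose c : ℝ) / F.choose c := by
  rw [uniformProb_eq_card_div]
  have h1 : Nat.card {s : Finset (Fin F) // s.card = c} = F.choose c := by
    rw [Nat.card_eq_fintype_card, Fintype.card_finset_len, Fintype.card_fin]
  have e : {s : {s : Finset (Fin F) // s.card = c} | Disjoint s.1 B} ≃
      {s // s ∈ Finset.powersetCard c Bᶜ} :=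
    { toFun := fun s => ⟨s.1.1, Finset.mem_powersetCard.2
        ⟨fun x hx => Finset.mem_compl.2 (Finset.disjoint_left.1 s.2 hx), s.1.2⟩⟩
      invFun := fun s => ⟨⟨s.1, (Finset.mem_powersetCard.1 s.2).2⟩,
        Finset.disjoint_left.2 fun x hx =>
          Finset.mem_compl.1 ((Finset.mem_powersetCard.1 s.2).1 hx)⟩
      left_inv := fun _ => rfl
      right_inv := fun _ => rfl }
  rw [h1, Nat.card_congr e, Nat.card_eq_fintype_card, Fintype.card_coe,
    Finset.card_powersetCard, Finset.card_compl, Fintype.card_fin]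

lemma nonempty_subsets {F c : ℕ} (h : c ≤ F) : Nonempty {s : Finset (Fin F) // s.card = c} := by
  obtain ⟨s, -, hs⟩ := Finset.exists_subset_card_eq (s := (Finset.univ : Finset (Fin F))) (n := c)
    (by simpa using h)
  exact ⟨⟨s, hs⟩⟩

lemma uniformProb_notMem {F c : ℕ} (h : c ≤ F) (b : Fin F) :
    uniformProb {s : {s : Finset (Fin F) // s.card = c} | b ∉ s.1} = 1 - c / F := by
  have hset : {s : {s : Finset (Fin F) // s.card = c} | b ∉ s.1} = {s | Disjoint s.1 {b}} := by
    ext s; simp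
  obtain ⟨f, rfl⟩ : ∃ f, F = f + 1 := ⟨F - 1, by have := b.pos; omega⟩
  rw [hset, uniformProb_disjoint]
  have hc : (0 : ℝ) < (f + 1).choose c := by exact_mod_cast Nat.choose_pos h
  have h1 := Nat.choose_mul_succ_eq f c
  have h2 : (f.choose c : ℝ) * (f + 1) = (f + 1).choose c * ((f : ℝ) + 1 - c) := by
    have : ((f + 1 - c : ℕ) : ℝ) = (f : ℝ) + 1 - c := by rw [Nat.cast_sub h]; push_cast; ring
    rw [← this]; exact_mod_cast h1
  simp only [Finset.card_singleton, Nat.add_sub_cancel]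
  rw [div_eq_iff hc.ne']
  push_cast
  field_simp
  linarith

lemma uniformProb_mem {F c : ℕ} (h : c ≤ F) (b : Fin F) :
    uniformProb {s : {s : Finset (Fin F) // s.card = c} | b ∈ s.1} = c / F := by
  have := nonempty_subsets h
  have h1 := uniformProb_compl {s : {s : Finset (Fin F) // s.card = c} | b ∈ s.1}
  have h2 := uniformProb_notMem h b
  have h3 : {s : {s : Finset (Fin F) // s.card = c} | b ∈ s.1}ᶜ = {s | b ∉ s.1} := rfl
  rw [h3, h2] at h1
  linarith

/-- Sampling without replacement: the exact value is `(1 - c/F) (1 - c/(F-1))` when `c ≤ F - 2`, and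
`0` for larger `c`. -/
lemma uniformProb_notMem_notMem_le {F c : ℕ} (h : c ≤ F) {b b' : Fin F} (hb : b ≠ b') :
    uniformProb {s : {s : Finset (Fin F) // s.card = c} | b ∉ s.1 ∧ b' ∉ s.1} ≤
      (1 - c / F : ℝ) ^ 2 := by
  have hset : {s : {s : Finset (Fin F) // s.card = c} | b ∉ s.1 ∧ b' ∉ s.1} =
      {s | Disjoint s.1 {b, b'}} := by
    ext s; simp
  obtain ⟨f, rfl⟩ : ∃ f, F = f + 2 := ⟨F - 2, by
    have := b.2; have := b'.2; have := Fin.val_ne_of_ne hb; omega⟩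
  rw [hset, uniformProb_disjoint, Finset.card_pair hb]
  have hc : (0 : ℝ) < (f + 2).choose c := by exact_mod_cast Nat.choose_pos h
  simp only [Nat.add_sub_cancel]
  rcases Nat.lt_or_ge f c with hfc | hfc
  · rw [Nat.choose_eq_zero_of_lt hfc]
    simp only [Nat.cast_zero, zero_div]
    positivity
  have h1 : (f.choose c : ℝ) * (f + 1) = (f + 1).choose c * ((f : ℝ) + 1 - c) := by
    have : ((f + 1 - c : ℕ) : ℝ) = (f : ℝ) + 1 - c := by
      rw [Nat.cast_sub (by omega)]; push_cast; ring
    rw [← this]; exact_mod_cast Nat.choose_mul_succ_eq f c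
  have h2 : ((f + 1).choose c : ℝ) * (f + 2) = (f + 2).choose c * ((f : ℝ) + 2 - c) := by
    have : ((f + 2 - c : ℕ) : ℝ) = (f : ℝ) + 2 - c := by
      rw [Nat.cast_sub h]; push_cast; ring
    rw [← this]
    have := Nat.choose_mul_succ_eq (f + 1) c
    exact_mod_cast this
  have hfc' : (c : ℝ) ≤ f := by exact_mod_cast hfc
  have hf : (0 : ℝ) ≤ f := by positivity
  have hc0 : (0 : ℝ) ≤ c := by positivity
  have h3 : ((f + 1).choose c : ℝ) = (f + 2).choose c * ((f : ℝ) + 2 - c) / (f + 2) := by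
    field_simp; linarith
  have h4 : (f.choose c : ℝ) = (f + 2).choose c * ((f : ℝ) + 2 - c) / (f + 2) *
      ((f : ℝ) + 1 - c) / (f + 1) := by
    rw [← h3]; field_simp; linarith
  rw [h4]
  have h5 : ((f + 2).choose c : ℝ) * ((f : ℝ) + 2 - c) / (f + 2) * ((f : ℝ) + 1 - c) / (f + 1) /
      (f + 2).choose c = (1 - c / (f + 2)) * (1 - c / (f + 1)) := by
    field_simp
  rw [h5, sq]
  push_cast
  have h6 : (c : ℝ) / (f + 2) ≤ c / (f + 1) := by gcongr; norm_num
  have h7 : (c : ℝ) / (f + 2) ≤ 1 := by rw [div_le_one (by positivity)]; linarith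
  exact mul_le_mul_of_nonneg_left (by linarith) (by linarith)

/-- By inclusion–exclusion two events and their complements have the same covariance, so this
reduces to `uniformProb_notMem_notMem_le`. -/
lemma uniformProb_mem_mem_le {F c : ℕ} (h : c ≤ F) {b b' : Fin F} (hb : b ≠ b') :
    uniformProb {s : {s : Finset (Fin F) // s.card = c} | b ∈ s.1 ∧ b' ∈ s.1} ≤
      (c / F : ℝ) ^ 2 := by
  classical
  have := nonempty_subsets h
  set Q := {s : Finset (Fin F) // s.card = c}
  have hQ : (0 : ℝ) < Fintype.card Q := by exact_mod_cast Fintype.card_pos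
  have key : uniformProb {s : Q | b ∈ s.1 ∧ b' ∈ s.1} =
      1 - uniformProb {s : Q | b ∉ s.1} - uniformProb {s : Q | b' ∉ s.1} +
        uniformProb {s : Q | b ∉ s.1 ∧ b' ∉ s.1} := by
    apply mul_right_cancel₀ hQ.ne'
    rw [add_mul, sub_mul, sub_mul]
    simp only [uniformProb_mul_card]
    have : (1 : ℝ) * Fintype.card Q = ∑ _s : Q, (1 : ℝ) := by simp
    rw [this, ← Finset.sum_sub_distrib, ← Finset.sum_sub_distrib, ← Finset.sum_add_distrib]
    refine Finset.sum_congr rfl fun s _ => ?_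
    by_cases h1 : b ∈ s.1 <;> by_cases h2 : b' ∈ s.1 <;> simp [h1, h2]
  rw [key, uniformProb_notMem h, uniformProb_notMem h]
  have := uniformProb_notMem_notMem_le h hb
  nlinarith

variable {K N F c : ℕ}

lemma uniformProb_placement (h : c ≤ F) (n : Fin N)
    (A : Fin K → Set {s : Finset (Fin F) // s.card = c}) :
    uniformProb {Z : Placement K N F c | ∀ k, Z k n ∈ A k} = ∏ k, uniformProb (A k) := by
  have := nonempty_subsets h
  have h1 := uniformProb_pi (X := fun _ : Fin K => Fin N → {s : Finset (Fin F) // s.card = c})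
    (fun k => {z | z n ∈ A k})
  refine h1.trans (Finset.prod_congr rfl fun k _ => ?_)
  exact uniformProb_pi_coord n (A k)

/-- The probability that a given bit is stored by exactly the users in a set of `s` of the `K`
users, when each user stores it with probability `p`. -/
noncomputable def exactProb (K : ℕ) (p : ℝ) (s : ℕ) : ℝ := p ^ s * (1 - p) ^ (K - s)

lemma prod_ite_mem_eq_exactProb (p : ℝ) (S : Finset (Fin K)) :
    ∏ k, (if k ∈ S then p else 1 - p) = exactProb K p S.card := by
  rw [Finset.prod_ite, exactProb]
  simp only [Finset.prod_const]
  congr 2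
  · congr 1; ext; simp
  · have : (Finset.univ.filter fun k => k ∉ S) = Sᶜ := by ext; simp
    rw [this, Finset.card_compl, Fintype.card_fin]

lemma mem_subfile {Z : Placement K N F c} {n : Fin N} {S : Finset (Fin K)} {b : Fin F} :
    b ∈ subfile Z n S ↔ ∀ k, b ∈ (Z k n).1 ↔ k ∈ S := by
  simp [subfile]

lemma uniformProb_mem_subfile (h : c ≤ F) (n : Fin N) (S : Finset (Fin K)) (b : Fin F) :
    uniformProb {Z : Placement K N F c | b ∈ subfile Z n S} = exactProb K (c / F) S.card := by
  have h1 := uniformProb_placement (K := K) h n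
    (fun k => {s | b ∈ s.1 ↔ k ∈ S})
  simp_rw [mem_subfile]
  refine h1.trans ?_
  rw [← prod_ite_mem_eq_exactProb]
  refine Finset.prod_congr rfl fun k _ => ?_
  split_ifs with hk
  · simpa [hk] using uniformProb_mem h b
  · simpa [hk] using uniformProb_notMem h b

/-- Users are independent, and for each of them the two bits are both required (`k ∈ S`) or both
excluded; either way the negative correlation for one random set applies. -/
lemma uniformProb_mem_mem_subfile_le (h : c ≤ F) (n : Fin N) (S : Finset (Fin K)) {b b' : Fin F}
    (hb : b ≠ b') :
    uniformProb ({Z : Placement K N F c | b ∈ subfile Z n S} ∩ {Z | b' ∈ subfile Z n S}) ≤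
      exactProb K (c / F) S.card ^ 2 := by
  have h1 := uniformProb_placement (K := K) h n
    (fun k => {s | (b ∈ s.1 ↔ k ∈ S) ∧ (b' ∈ s.1 ↔ k ∈ S)})
  have h2 : {Z : Placement K N F c | b ∈ subfile Z n S} ∩ {Z | b' ∈ subfile Z n S} =
      {Z | ∀ k, Z k n ∈ {s : {s : Finset (Fin F) // s.card = c} |
        (b ∈ s.1 ↔ k ∈ S) ∧ (b' ∈ s.1 ↔ k ∈ S)}} := by
    ext Z
    simp [mem_subfile, forall_and]
  rw [h2, h1, ← prod_ite_mem_eq_exactProb, ← Finset.prod_pow]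
  refine Finset.prod_le_prod (fun k _ => uniformProb_nonneg _) fun k _ => ?_
  split_ifs with hk
  · simpa [hk] using uniformProb_mem_mem_le h hb
  · simpa [hk] using uniformProb_notMem_notMem_le h hb

lemma uniformProb_subfile_deviation_le (h : c ≤ F) (hF : 0 < F) (n : Fin N) (S : Finset (Fin K))
    {η : ℝ} (hη : 0 < η) :
    uniformProb {Z : Placement K N F c |
      η * F < |((subfile Z n S).card : ℝ) - F * exactProb K (c / F) S.card|} ≤
      1 / (η ^ 2 * F) := by
  have : Nonempty (Fin F) := ⟨⟨0, hF⟩⟩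
  have h1 := uniformProb_card_deviation_le
    (fun b : Fin F => {Z : Placement K N F c | b ∈ subfile Z n S})
    (uniformProb_mem_subfile h n S) (fun b b' hb => uniformProb_mem_mem_subfile_le h n S hb) hη
  simpa using h1

lemma cachedBits_le {N : ℕ} {M : ℝ} (hM : M ≤ N) (hN : 1 ≤ N) (F : ℕ) : cachedBits N M F ≤ F := by
  have : (0 : ℝ) < N := by exact_mod_cast hN
  apply Nat.floor_le_of_le
  exact mul_le_of_le_one_left (by positivity) ((div_le_one this).2 hM)

lemma tendsto_cachedBits {N : ℕ} {M : ℝ} (hM : 0 ≤ M) :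
    Tendsto (fun F : ℕ => (cachedBits N M F : ℝ) / F) atTop (𝓝 (M / N)) :=
  (tendsto_nat_floor_mul_div_atTop (div_nonneg hM (Nat.cast_nonneg N))).comp
    tendsto_natCast_atTop_atTop

/-- With high probability all subfiles have about the expected size. -/
lemma tendsto_uniformProb_subfile (K : ℕ) {N : ℕ} {M : ℝ} (hN : 1 ≤ N) (hM0 : 0 ≤ M) (hM : M ≤ N)
    {η : ℝ} (hη : 0 < η) :
    Tendsto (fun F : ℕ => uniformProb {Z : Placement K N F (cachedBits N M F) |
      ∀ n S, |((subfile Z n S).card : ℝ) - F * exactProb K (M / N) S.card| ≤ η * F})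
      atTop (𝓝 1) := by
  have hlim : Tendsto (fun F : ℕ => 1 - (Fintype.card (Fin N × Finset (Fin K)) : ℝ) *
      (1 / ((η / 2) ^ 2 * F))) atTop (𝓝 1) := by
    have h1 : Tendsto (fun F : ℕ => (1 : ℝ) / ((η / 2) ^ 2 * F)) atTop (𝓝 0) := by
      simp_rw [one_div]
      exact (tendsto_natCast_atTop_atTop.const_mul_atTop (by positivity)).inv_tendsto_atTop
    simpa using (h1.const_mul (Fintype.card (Fin N × Finset (Fin K)) : ℝ)).const_sub 1
  -- Half of `η` absorbs the replacement of `M / N` by the rounded ratio `c / F`; the other half is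
  -- left to Chebyshev.
  have hq : ∀ S : Finset (Fin K), ∀ᶠ F : ℕ in atTop,
      |exactProb K ((cachedBits N M F : ℝ) / F) S.card - exactProb K (M / N) S.card| < η / 2 := by
    intro S
    have hcont : Continuous fun p : ℝ => exactProb K p S.card := by
      unfold exactProb; fun_prop
    have h1 := (hcont.tendsto (M / N)).comp (tendsto_cachedBits (N := N) hM0)
    have h2 := Metric.tendsto_nhds.1 h1 (η / 2) (by positivity)
    simpa [Real.dist_eq] using h2
  refine tendsto_of_tendsto_of_tendsto_of_le_of_le' hlim tendsto_const_nhds ?_ ?_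
  · filter_upwards [eventually_all.2 hq, eventually_gt_atTop 0] with F hF hF0
    have hc := cachedBits_le hM hN F
    have := nonempty_subsets hc
    refine one_sub_le_uniformProb (ι := Fin N × Finset (Fin K))
      (fun x => uniformProb_subfile_deviation_le hc hF0 x.1 x.2 (half_pos hη)) ?_
    intro Z hZ n S
    have h1 := hZ (n, S)
    simp only [Set.mem_ofPred_eq, not_lt] at h1
    have h2 := hF S
    have hFr : (0 : ℝ) < F := by exact_mod_cast hF0
    rw [abs_le] at h1 ⊢
    rw [abs_lt] at h2
    constructor <;> nlinarith
  · exact Eventually.of_forall fun F => uniformProb_le_one _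

end Concentration

/-! ### Block lengths and the coding delay. -/

section Delay

lemma groupSize_le (K L α : ℕ) : groupSize K L α ≤ K := min_le_right _ _

lemma le_groupSize {K L α : ℕ} (hL : 1 ≤ L) (hα : α ≤ K) : α ≤ groupSize K L α :=
  le_min (by omega) hα

lemma numMini_pos {K L α : ℕ} : 0 < numMini K L α :=
  Nat.choose_pos (Nat.sub_le_sub_right (groupSize_le K L α) α)

/-- The groups of `t` users which contain `U`. -/
def supersets {K : ℕ} (t : ℕ) (U : Finset (Fin K)) : Finset (Finset (Fin K)) :=
  (Finset.powersetCard t Finset.univ).filter fun T => U ⊆ T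

lemma mem_supersets {K t : ℕ} {U T : Finset (Fin K)} :
    T ∈ supersets t U ↔ T.card = t ∧ U ⊆ T := by
  simp [supersets, Finset.mem_powersetCard]

lemma card_supersets {K t : ℕ} (U : Finset (Fin K)) (h : U.card ≤ t) :
    (supersets t U).card = (K - U.card).choose (t - U.card) := by
  have h1 : (Finset.powersetCard (t - U.card) Uᶜ).card = (K - U.card).choose (t - U.card) := by
    rw [Finset.card_powersetCard, Finset.card_compl, Fintype.card_fin]
  rw [← h1]
  refine Finset.card_bij' (fun T _ => T \ U) (fun V _ => V ∪ U) ?_ ?_ ?_ ?_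
  · intro T hT
    obtain ⟨h1, h2⟩ := mem_supersets.1 hT
    rw [Finset.mem_powersetCard, Finset.card_sdiff_of_subset h2, h1]
    exact ⟨fun x hx => Finset.mem_compl.2 (Finset.mem_sdiff.1 hx).2, rfl⟩
  · intro V hV
    obtain ⟨h1, h2⟩ := Finset.mem_powersetCard.1 hV
    have hd : Disjoint V U := Finset.disjoint_left.2 fun x hx => Finset.mem_compl.1 (h1 hx)
    rw [mem_supersets, Finset.card_union_of_disjoint hd, h2]
    exact ⟨by omega, Finset.subset_union_right⟩
  · intro T hT
    exact Finset.sdiff_union_of_subset (mem_supersets.1 hT).2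
  · intro V hV
    have hd : Disjoint V U := Finset.disjoint_left.2 fun x hx =>
      Finset.mem_compl.1 ((Finset.mem_powersetCard.1 hV).1 hx)
    change (V ∪ U) \ U = V
    rw [Finset.union_sdiff_right, hd.sdiff_eq_left]

lemma miniIndex_eq {K : ℕ} (T U : Finset (Fin K)) :
    miniIndex T U =
      ((supersets T.card U).filter fun T' => toColex T' < toColex T).card := by
  rw [miniIndex, supersets, Finset.filter_filter]

lemma miniIndex_lt {K : ℕ} {T U : Finset (Fin K)} (h : U ⊆ T) :
    miniIndex T U < (K - U.card).choose (T.card - U.card) := by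
  rw [miniIndex_eq, ← card_supersets U (Finset.card_le_card h)]
  refine Finset.card_lt_card ⟨Finset.filter_subset _ _, fun hs => ?_⟩
  have := hs (mem_supersets.2 ⟨rfl, h⟩)
  simp at this

lemma miniIndex_lt_numMini {K L α : ℕ} {T U : Finset (Fin K)} (h : U ⊆ T) (hU : U.card = α)
    (hT : T.card = groupSize K L α) : miniIndex T U < numMini K L α := by
  have := miniIndex_lt h
  rwa [hU, hT] at this

variable {K N F c : ℕ}

lemma miniBits_eq (Z : Placement K N F c) (n : Fin N) (S : Finset (Fin K)) {a j : ℕ} (hj : j < a) :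
    miniBits Z n S a j =
      (subfile Z n S).card / a + if j < (subfile Z n S).card % a then 1 else 0 := by
  have h := Nat.count_modEq_card (subfile Z n S).card (r := a) (by omega) j
  rw [Nat.mod_eq_of_lt hj] at h
  rw [← h, Nat.count_eq_card_filter_range, miniBits]
  congr 1
  refine Finset.filter_congr fun i _ => ?_
  rw [Nat.ModEq, Nat.mod_eq_of_lt hj]

lemma lt_miniBits (Z : Placement K N F c) (n : Fin N) (S : Finset (Fin K)) {a j x : ℕ} (hj : j < a)
    (hx : j + a * x < (subfile Z n S).card) : x < miniBits Z n S a j := by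
  rw [miniBits_eq Z n S hj]
  have h1 := Nat.div_add_mod (subfile Z n S).card a
  set y := (subfile Z n S).card / a
  by_contra! hxy
  split_ifs at hxy with h
  · have : a * (y + 1) ≤ a * x := Nat.mul_le_mul_left a hxy
    have := Nat.mod_lt (subfile Z n S).card (by omega : 0 < a)
    rw [mul_add] at *
    omega
  · have : a * y ≤ a * x := Nat.mul_le_mul_left a (by simpa using hxy)
    omega

lemma abs_miniBits_sub_le (Z : Placement K N F c) (n : Fin N) (S : Finset (Fin K)) {a j : ℕ}
    (hj : j < a) : |(miniBits Z n S a j : ℝ) - (subfile Z n S).card / a| ≤ 1 := by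
  rw [miniBits_eq Z n S hj]
  have ha : (0 : ℝ) < a := by exact_mod_cast (by omega : 0 < a)
  set N' := (subfile Z n S).card
  have h1 : ((N' / a : ℕ) : ℝ) ≤ N' / a := Nat.cast_div_le
  have h2 : (N' : ℝ) / a ≤ (N' / a : ℕ) + 1 := by
    rw [div_le_iff₀ ha]
    have := Nat.lt_div_mul_add (a := N') (b := a) (by omega)
    have : N' ≤ (N' / a + 1) * a := by rw [add_mul]; omega
    exact_mod_cast this
  have h3 : (0 : ℝ) ≤ ((if j < N' % a then 1 else 0 : ℕ) : ℝ) := by positivity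
  have h4 : ((if j < N' % a then 1 else 0 : ℕ) : ℝ) ≤ 1 := by split_ifs <;> simp
  rw [abs_le]
  push_cast at *
  constructor <;> linarith

lemma abs_mul_ceilDiv_sub_le {m : ℕ} (hm : 0 < m) (x : ℕ) :
    |(m : ℝ) * (x ⌈/⌉ m : ℕ) - x| ≤ m := by
  have h1 : x ≤ m * (x ⌈/⌉ m) := by simpa using le_smul_ceilDiv hm (b := x)
  have h2 : m * (x ⌈/⌉ m) ≤ x + m := by
    rw [Nat.ceilDiv_eq_add_pred_div]
    have := Nat.mul_div_le (x + m - 1) m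
    omega
  have h1' : (x : ℝ) ≤ m * (x ⌈/⌉ m : ℕ) := by exact_mod_cast h1
  have h2' : (m : ℝ) * (x ⌈/⌉ m : ℕ) ≤ x + m := by exact_mod_cast h2
  rw [abs_le]
  constructor <;> linarith [(Nat.cast_nonneg m : (0 : ℝ) ≤ m)]

/-- A finite supremum is attained. This is why neither padding to the longest mini-file nor taking
the worst demand worsens the error. -/
lemma abs_mul_sup_sub_le {ι : Type*} {s : Finset ι} (hs : s.Nonempty) (f : ι → ℕ) {m v E : ℝ}
    (h : ∀ i ∈ s, |m * f i - v| ≤ E) : |m * (s.sup f : ℕ) - v| ≤ E := by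
  obtain ⟨i, hi, he⟩ := Finset.exists_mem_eq_sup s hs f
  rw [he]
  exact h i hi

/-- In the error, `B` comes from the subfile sizes, `1` from the uneven division into mini-files,
and `m` from rounding up to whole symbols. -/
lemma abs_blockLength_sub_le {L m α : ℕ} (hm : 0 < m) (hL : 1 ≤ L) (hα1 : 1 ≤ α) (hαK : α ≤ K)
    (Z : Placement K N F c) (d : Fin K → Fin N) {T : Finset (Fin K)}
    (hT : T.card = groupSize K L α) {p B : ℝ}
    (hZ : ∀ n S, |((subfile Z n S).card : ℝ) - F * exactProb K p S.card| ≤ B) :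
    |(m : ℝ) * blockLength L m Z d α T - F * exactProb K p (α - 1) / numMini K L α| ≤
      B + 1 + m := by
  refine abs_mul_sup_sub_le ?_ _ fun U hU => ?_
  · rw [Finset.powersetCard_nonempty, hT]
    exact le_groupSize hL hαK
  obtain ⟨hUT, hUc⟩ := Finset.mem_powersetCard.1 hU
  refine abs_mul_sup_sub_le (Finset.card_pos.1 (by omega)) _ fun r hr => ?_
  have hj := miniIndex_lt_numMini hUT hUc hT
  have hS : (U \ {r}).card = α - 1 := by
    rw [Finset.card_sdiff_of_subset (by simpa using hr), hUc, Finset.card_singleton]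
  have h1 := hZ (d r) (U \ {r})
  rw [hS] at h1
  have h2 := abs_miniBits_sub_le Z (d r) (U \ {r}) hj
  have h3 := abs_mul_ceilDiv_sub_le hm
    (miniBits Z (d r) (U \ {r}) (numMini K L α) (miniIndex T U))
  have ha : (1 : ℝ) ≤ numMini K L α := by exact_mod_cast (numMini_pos : 0 < numMini K L α)
  have h4 : |((subfile Z (d r) (U \ {r})).card : ℝ) / numMini K L α -
      F * exactProb K p (α - 1) / numMini K L α| ≤ B := by
    rw [← sub_div, abs_div, abs_of_pos (by linarith : (0 : ℝ) < numMini K L α)]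
    exact (div_le_self (abs_nonneg _) ha).trans h1
  rw [abs_le] at *
  constructor <;> linarith

lemma card_channelUse (L m : ℕ) (Z : Placement K N F c) (d : Fin K → Fin N) :
    Fintype.card (ChannelUse L m Z d) =
      ∑ α : Order K, ∑ T : Group K L α, numRepeats K L α * blockLength L m Z d α T := by
  simp [ChannelUse, Fintype.card_sigma]

lemma card_group (K L α : ℕ) : Fintype.card (Group K L α) = K.choose (groupSize K L α) := by
  rw [Fintype.card_finset_len, Fintype.card_fin]

/-- Count pairs `U ⊆ T` with sizes `α` and `t` in two ways, and combine with the absorption identity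
for `t.choose α`. The left side is groups times repetitions per mini-file of a subfile. -/
lemma choose_mul_choose_div {K α t : ℕ} (h1 : 1 ≤ α) (h2 : α ≤ t) (h3 : t ≤ K) :
    (K.choose t : ℝ) * ((t - 1).choose (α - 1) : ℝ) / (K - α).choose (t - α) =
      K.choose α * (α / t) := by
  have ha : (0 : ℝ) < (K - α).choose (t - α) := by exact_mod_cast Nat.choose_pos (by omega)
  have ht : (0 : ℝ) < t := by exact_mod_cast (by omega : 0 < t)
  have e1 : (K.choose t : ℝ) * t.choose α = K.choose α * (K - α).choose (t - α) := by
    exact_mod_cast Nat.choose_mul h2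
  have e2 : (t : ℝ) * (t - 1).choose (α - 1) = t.choose α * α := by
    have := Nat.add_one_mul_choose_eq (t - 1) (α - 1)
    rw [Nat.sub_add_cancel (by omega), Nat.sub_add_cancel h1] at this
    exact_mod_cast this
  rw [div_eq_iff ha.ne']
  field_simp
  linear_combination (K.choose t : ℝ) * e2 + (α : ℝ) * e1

lemma sum_blocks_eq_delay {L : ℕ} (hL : 1 ≤ L) (F : ℝ) (M : ℝ) :
    ∑ α : Order K, ∑ _T : Group K L α, (numRepeats K L α : ℝ) *
      (F * exactProb K (M / N) (α - 1) / numMini K L α) = F * delay K L N M := by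
  simp only [Finset.sum_const, Finset.card_univ, card_group, nsmul_eq_mul]
  rw [delay, Finset.mul_sum]
  refine (Finset.sum_coe_sort (Finset.Icc 1 K) (fun α => (K.choose (groupSize K L α) : ℝ) *
    ((numRepeats K L α : ℝ) * (F * exactProb K (M / N) (α - 1) / numMini K L α)))).trans ?_
  refine Finset.sum_congr rfl fun α hα => ?_
  obtain ⟨h1, h2⟩ := Finset.mem_Icc.1 hα
  have h := choose_mul_choose_div h1 (le_groupSize hL h2) (groupSize_le K L α)
  have hK : K - (α - 1) = K - α + 1 := by omega
  have ht : min (α + L - 1) K = groupSize K L α := rfl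
  rw [exactProb, hK, ht, numRepeats, numMini]
  linear_combination F * (M / N) ^ (α - 1) * (1 - M / N) ^ (K - α + 1) * h

lemma abs_codingDelay_sub_le {L m : ℕ} (hm : 0 < m) (hL : 1 ≤ L) (hN : 1 ≤ N)
    (Z : Placement K N F c) {M B : ℝ}
    (hZ : ∀ n S, |((subfile Z n S).card : ℝ) - F * exactProb K (M / N) S.card| ≤ B) :
    |(m : ℝ) * codingDelay L m Z - F * delay K L N M| ≤
      (∑ α : Order K, ∑ _T : Group K L α, (numRepeats K L α : ℝ)) * (B + 1 + m) := by
  have : Nonempty (Fin N) := ⟨⟨0, hN⟩⟩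
  refine abs_mul_sup_sub_le Finset.univ_nonempty _ fun d _ => ?_
  rw [card_channelUse, ← sum_blocks_eq_delay hL]
  push_cast
  rw [Finset.mul_sum, ← Finset.sum_sub_distrib, Finset.sum_mul]
  refine (Finset.abs_sum_le_sum_abs _ _).trans (Finset.sum_le_sum fun α _ => ?_)
  rw [Finset.mul_sum, ← Finset.sum_sub_distrib, Finset.sum_mul]
  refine (Finset.abs_sum_le_sum_abs _ _).trans (Finset.sum_le_sum fun T _ => ?_)
  obtain ⟨h1, h2⟩ := Finset.mem_Icc.1 α.2
  have h := abs_blockLength_sub_le hm hL h1 h2 Z d T.2 hZ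
  rw [show ∀ a b c v : ℝ, a * (b * c) - b * v = b * (a * c - v) by intros; ring, abs_mul,
    Nat.abs_cast]
  exact mul_le_mul_of_nonneg_left h (Nat.cast_nonneg _)

/-- If decoding succeeds for every placement, the algorithm achieves the delay `delay K L N M`. -/
lemma achieves_of_allDecode {𝔽 : Type} [Field 𝔽] {L m : ℕ} (hm : 0 < m) (hL : 1 ≤ L) (hN : 1 ≤ N)
    {M : ℝ} (hM0 : 0 ≤ M) (hM : M ≤ N) (e : (Fin m → Bool) ≃ 𝔽) (H : Matrix (Fin K) (Fin L) 𝔽)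
    (φ : Coefficients 𝔽 K L) (ψ : Finset (Fin K) → Fin L → 𝔽)
    (hdec : ∀ (F c : ℕ) (Z : Placement K N F c), AllDecode e H φ ψ Z) :
    Achieves N M e H φ ψ (delay K L N M) := by
  intro ε hε
  set C : ℝ := ∑ α : Order K, ∑ _T : Group K L α, (numRepeats K L α : ℝ) with hC
  have hC0 : 0 ≤ C := by positivity
  -- This `η` makes `C η ≤ ε / 2`; the `+ 1` covers `C = 0`, which occurs for `K = 0`. The other `ε
  -- / 2` pays for the bounded overhead `C (1 + m)`.
  have hη : 0 < ε / (2 * (C + 1)) := by positivity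
  have hsmall : ∀ᶠ F : ℕ in atTop, C * (1 + m) / F ≤ ε / 2 := by
    have h := tendsto_const_div_atTop_nhds_zero_nat (C * (1 + m))
    exact h.eventually (Iic_mem_nhds (half_pos hε))
  refine tendsto_of_tendsto_of_tendsto_of_le_of_le' (tendsto_uniformProb_subfile K hN hM0 hM hη)
    tendsto_const_nhds ?_ (Eventually.of_forall fun F => uniformProb_le_one _)
  filter_upwards [hsmall, eventually_gt_atTop 0] with F hF hF0
  refine uniformProb_mono fun Z hZ => ⟨hdec F _ Z, ?_⟩
  have h := abs_codingDelay_sub_le hm hL hN Z hZ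
  rw [← hC] at h
  have hFr : (0 : ℝ) < F := by exact_mod_cast hF0
  have hmr : (0 : ℝ) < m := by exact_mod_cast hm
  have e1 : (codingDelay L m Z : ℝ) / ((F : ℝ) / m) - delay K L N M =
      ((m : ℝ) * codingDelay L m Z - F * delay K L N M) / F := by
    field_simp
  rw [e1, abs_div, abs_of_pos hFr, div_le_iff₀ hFr]
  rw [div_le_iff₀ hFr] at hF
  have h2 : C * (ε / (2 * (C + 1))) ≤ ε / 2 := by
    rw [mul_div_assoc', div_le_div_iff₀ (by positivity) (by positivity)]
    nlinarith
  calc _ ≤ C * (ε / (2 * (C + 1)) * F + 1 + m) := h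
    _ = C * (ε / (2 * (C + 1))) * F + C * (1 + m) := by ring
    _ ≤ ε / 2 * F + ε / 2 * F := by
      have := mul_le_mul_of_nonneg_right h2 hFr.le
      linarith
    _ = ε * F := by ring

end Delay

/-! ### Decoding for an arbitrary placement. -/

section Decoding

variable {K N F c : ℕ}

/-- The counter is strictly increasing in the colexicographic order, hence injective on the `t`-sets
containing `U`; there are exactly as many of these as admissible values, so it is onto. -/
lemma exists_miniIndex_eq {t j : ℕ} (U : Finset (Fin K)) (ht : U.card ≤ t)
    (hj : j < (K - U.card).choose (t - U.card)) :
    ∃ T : Finset (Fin K), T.card = t ∧ U ⊆ T ∧ miniIndex T U = j := by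
  have hinj : Set.InjOn (fun T => miniIndex T U) (supersets t U : Set (Finset (Fin K))) := by
    have hlt : ∀ T₁ ∈ supersets t U, ∀ T₂ ∈ supersets t U, toColex T₁ < toColex T₂ →
        miniIndex T₁ U < miniIndex T₂ U := by
      intro T₁ h₁ T₂ h₂ h
      rw [miniIndex_eq, miniIndex_eq, (mem_supersets.1 h₁).1, (mem_supersets.1 h₂).1]
      refine Finset.card_lt_card ⟨fun T hT => ?_, fun hs => ?_⟩
      · rw [Finset.mem_filter] at hT ⊢
        exact ⟨hT.1, hT.2.trans h⟩
      · have := hs (Finset.mem_filter.2 ⟨h₁, h⟩)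
        simp at this
    intro T₁ h₁ T₂ h₂ h
    rcases lt_trichotomy (toColex T₁) (toColex T₂) with h' | h' | h'
    · exact absurd h (hlt T₁ h₁ T₂ h₂ h').ne
    · exact toColex_inj.1 h'
    · exact absurd h (hlt T₂ h₂ T₁ h₁ h').ne'
  have hmaps : Set.MapsTo (fun T => miniIndex T U) (supersets t U : Set (Finset (Fin K)))
      (Finset.range ((K - U.card).choose (t - U.card)) : Set ℕ) := by
    intro T hT
    obtain ⟨h1, h2⟩ := mem_supersets.1 hT
    have := miniIndex_lt h2
    rw [h1] at this
    simpa using this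
  have hsurj := Finset.surjOn_of_injOn_of_card_le _ hmaps hinj
    (by rw [Finset.card_range, card_supersets U ht])
  obtain ⟨T, hT, h⟩ := hsurj (Finset.mem_coe.2 (Finset.mem_range.2 hj))
  exact ⟨T, (mem_supersets.1 hT).1, (mem_supersets.1 hT).2, h⟩

/-- The sets `U ⊆ T` of `α` users which contain the user `k`. -/
def servedWith (α : ℕ) (T : Finset (Fin K)) (k : Fin K) : Finset (Finset (Fin K)) :=
  (Finset.powersetCard α T).filter fun U => k ∈ U

lemma mem_servedWith {α : ℕ} {T U : Finset (Fin K)} {k : Fin K} :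
    U ∈ servedWith α T k ↔ U ∈ Finset.powersetCard α T ∧ k ∈ U := Finset.mem_filter

/-- For every user of every group, the coefficients of its symbols in the repeated transmissions
form a matrix with linearly independent columns. -/
def IsGeneric {𝔽 : Type} [Field 𝔽] {L : ℕ} (φ : Coefficients 𝔽 K L) : Prop :=
  ∀ (α : Order K) (T : Group K L α) (k : Fin K),
    LinearIndependent 𝔽 fun (U : {U // U ∈ servedWith α.1 T.1 k}) ω => φ α T ω U.1 k

/-- Every bit of a subfile with `k ∈ S` lies in the cache of `k`. This lets the user cancel
interference. -/
lemma miniWord_congr (m : ℕ) (Z : Placement K N F c) {W W' : Library N F} {k : Fin K}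
    (hW : ∀ n, ∀ b ∈ (Z k n).1, W n b = W' n b) (n : Fin N) {S : Finset (Fin K)} (hk : k ∈ S)
    (a j p : ℕ) : miniWord m Z W n S a j p = miniWord m Z W' n S a j p := by
  funext l
  unfold miniWord
  split_ifs with h
  · refine hW n _ ?_
    have hmem := (Finset.mem_sort _).1 (List.getElem_mem h)
    exact (mem_subfile.1 hmem k).2 hk
  · rfl

/-- A user which does not know the symbols intended for it is able to resolve them. -/
lemma miniWord_eq_of_received_eq {𝔽 : Type} [Field 𝔽] {L m : ℕ} (e : (Fin m → Bool) ≃ 𝔽)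
    {H : Matrix (Fin K) (Fin L) 𝔽} {φ : Coefficients 𝔽 K L} {ψ : Finset (Fin K) → Fin L → 𝔽}
    (hφ : IsGeneric φ) (hψ : IsZeroForcing H ψ) (Z : Placement K N F c) (d : Fin K → Fin N)
    {k : Fin K} {W W' : Library N F} (hr : received e H φ ψ Z W d k = received e H φ ψ Z W' d k)
    (hW : ∀ n, ∀ b ∈ (Z k n).1, W n b = W' n b) (α : Order K) (T : Group K L α)
    {U : Finset (Fin K)} (hU : U ∈ servedWith α.1 T.1 k) {p : ℕ}
    (hp : p < blockLength L m Z d α T) :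
    miniWord m Z W (d k) (U \ {k}) (numMini K L α) (miniIndex T.1 U) p =
      miniWord m Z W' (d k) (U \ {k}) (numMini K L α) (miniIndex T.1 U) p := by
  set w : Library N F → Finset (Fin K) → Fin K → 𝔽 := fun W U r =>
    e (miniWord m Z W (d r) (U \ {r}) (numMini K L α) (miniIndex T.1 U) p) with hw
  have hkT : k ∈ T.1 := by
    obtain ⟨h1, h2⟩ := mem_servedWith.1 hU
    exact (Finset.mem_powersetCard.1 h1).1 h2
  have hrec : ∀ (W : Library N F) (ω : Fin (numRepeats K L α)),
      received e H φ ψ Z W d k ⟨α, T, ω, ⟨p, hp⟩⟩ =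
        ∑ U ∈ Finset.powersetCard α.1 T.1,
          (∑ r ∈ U, φ α T ω U r * w W U r) * (H k ⬝ᵥ ψ (T.1 \ U)) := by
    intro W ω
    simp only [received, sent, Matrix.mulVec, dotProduct_sum, dotProduct_smul, smul_eq_mul, hw]
  -- The unknowns: differences of wanted symbols, weighted by the effective gain. Subtracting the
  -- two received signals exhibits them as a vanishing combination of independent columns;
  -- zero-forcing makes the gain nonzero, so it can be divided out.
  set y : {U // U ∈ servedWith α.1 T.1 k} → 𝔽 := fun U =>
    (w W U k - w W' U k) * (H k ⬝ᵥ ψ (T.1 \ U.1)) with hy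
  have hzero : ∀ U, y U = 0 := by
    refine Fintype.linearIndependent_iff.1 (hφ α T k) y ?_
    funext ω
    have h := congrFun hr ⟨α, T, ω, ⟨p, hp⟩⟩
    rw [hrec, hrec, ← sub_eq_zero, ← Finset.sum_sub_distrib] at h
    rw [Finset.sum_apply, Pi.zero_apply, ← h]
    rw [← Finset.sum_filter_add_sum_filter_not (Finset.powersetCard α.1 T.1)
      (fun U => k ∈ U)]
    rw [Finset.sum_eq_zero (s := (Finset.powersetCard α.1 T.1).filter fun U => k ∉ U), add_zero]
    · refine (Finset.sum_coe_sort (servedWith α.1 T.1 k) (fun U =>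
        (((w W U k - w W' U k) * (H k ⬝ᵥ ψ (T.1 \ U))) • fun ω => φ α T ω U k) ω)).trans ?_
      refine Finset.sum_congr rfl fun U hU => ?_
      have hkU := (mem_servedWith.1 hU).2
      rw [← sub_mul, ← Finset.sum_sub_distrib, Finset.sum_eq_single_of_mem k hkU]
      · simp only [Pi.smul_apply, smul_eq_mul]
        ring
      · intro r _ hrk
        have hkr : k ∈ U \ {r} := by simp [hkU, Ne.symm hrk]
        simp only [hw]
        rw [miniWord_congr m Z hW (d r) hkr, sub_self]
    · intro U hU
      obtain ⟨h1, h2⟩ := Finset.mem_filter.1 hU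
      rw [(hψ α T U h1).1 k (Finset.mem_sdiff.2 ⟨hkT, h2⟩)]
      ring
  have h := hzero ⟨U, hU⟩
  obtain ⟨h1, h2⟩ := mem_servedWith.1 hU
  have h3 := (mul_eq_zero.1 h).resolve_right ((hψ α T U h1).2 k h2)
  exact e.injective (sub_eq_zero.1 h3)

lemma lt_blockLength {L m α : ℕ} (Z : Placement K N F c) (d : Fin K → Fin N) {T U : Finset (Fin K)}
    (hU : U ∈ Finset.powersetCard α T) {k : Fin K} (hk : k ∈ U) {p : ℕ}
    (hp : p < miniBits Z (d k) (U \ {k}) (numMini K L α) (miniIndex T U) ⌈/⌉ m) :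
    p < blockLength L m Z d α T := by
  refine hp.trans_le ?_
  refine le_trans ?_ (Finset.le_sup (f := fun U => U.sup fun r =>
    miniBits Z (d r) (U \ {r}) (numMini K L α) (miniIndex T U) ⌈/⌉ m) hU)
  exact Finset.le_sup (f := fun r =>
    miniBits Z (d r) (U \ {r}) (numMini K L α) (miniIndex T U) ⌈/⌉ m) hk

lemma div_lt_ceilDiv {m x y : ℕ} (hm : 0 < m) (h : x < y) : x / m < y ⌈/⌉ m := by
  rw [Nat.ceilDiv_eq_add_pred_div, Nat.div_lt_iff_lt_mul hm]
  have := Nat.lt_div_mul_add (a := y + m - 1) hm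
  omega

/-- Generic coefficients and zero-forcing vectors let all users decode, for every placement. -/
lemma allDecode {𝔽 : Type} [Field 𝔽] {L m : ℕ} (hm : 0 < m) (hL : 1 ≤ L) (e : (Fin m → Bool) ≃ 𝔽)
    {H : Matrix (Fin K) (Fin L) 𝔽} {φ : Coefficients 𝔽 K L} {ψ : Finset (Fin K) → Fin L → 𝔽}
    (hφ : IsGeneric φ) (hψ : IsZeroForcing H ψ) (Z : Placement K N F c) :
    AllDecode e H φ ψ Z := by
  intro d k
  suffices hinj : ∀ W W' : Library N F,
      received e H φ ψ Z W d k = received e H φ ψ Z W' d k →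
      cacheContent Z W k = cacheContent Z W' k → W (d k) = W' (d k) by
    classical
    refine ⟨fun r s => if h : ∃ W, received e H φ ψ Z W d k = r ∧ cacheContent Z W k = s then
      h.choose (d k) else fun _ => false, fun W => ?_⟩
    have h : ∃ W', received e H φ ψ Z W' d k = received e H φ ψ Z W d k ∧
      cacheContent Z W' k = cacheContent Z W k := ⟨W, rfl, rfl⟩
    exact (dif_pos h).trans (hinj _ _ h.choose_spec.1 h.choose_spec.2)
  intro W W' hr hc
  have hW : ∀ n, ∀ b ∈ (Z k n).1, W n b = W' n b := fun n b hb =>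
    congrFun (congrFun hc n) ⟨b, hb⟩
  funext b
  by_cases hb : b ∈ (Z k (d k)).1
  · exact hW _ b hb
  -- A missing bit belongs to the subfile of exactly the users caching it; it is delivered to `k`
  -- through `U = S ∪ {k}`.
  set S : Finset (Fin K) := Finset.univ.filter fun r => b ∈ (Z r (d k)).1 with hS
  have hkS : k ∉ S := by simpa [hS] using hb
  have hbS : b ∈ subfile Z (d k) S := mem_subfile.2 fun r => by simp [hS]
  set U := insert k S with hU
  have hkU : k ∈ U := Finset.mem_insert_self k S
  have hUS : U \ {k} = S := by
    rw [Finset.sdiff_singleton_eq_erase, hU, Finset.erase_insert hkS]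
  have hα1 : 1 ≤ U.card := Finset.card_pos.2 ⟨k, hkU⟩
  have hαK : U.card ≤ K := by simpa using Finset.card_le_univ U
  obtain ⟨i, hi, hib⟩ := List.getElem_of_mem ((Finset.mem_sort (· ≤ ·)).2 hbS)
  set a := numMini K L U.card with ha
  have ha0 : 0 < a := numMini_pos
  -- The bit of rank `i` sits in mini-file `i % a` at position `i / a`, that is, in symbol `i / a /
  -- m` as bit `i / a % m`.
  obtain ⟨T, hTc, hUT, hTj⟩ := exists_miniIndex_eq (t := groupSize K L U.card) (j := i % a) U
    (le_groupSize hL hαK) (Nat.mod_lt _ ha0)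
  have hUp : U ∈ Finset.powersetCard U.card T := Finset.mem_powersetCard.2 ⟨hUT, rfl⟩
  have hp : i / a / m < blockLength L m Z d U.card T := by
    refine lt_blockLength Z d hUp hkU (div_lt_ceilDiv hm (lt_miniBits Z _ _ ?_ ?_))
    · rw [hTj]; exact Nat.mod_lt _ ha0
    · rw [hTj, hUS, ← ha, Nat.mod_add_div]
      simpa using hi
  have h := miniWord_eq_of_received_eq e hφ hψ Z d hr hW ⟨U.card, Finset.mem_Icc.2 ⟨hα1, hαK⟩⟩
    ⟨T, hTc⟩ (mem_servedWith.2 ⟨hUp, hkU⟩) hp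
  have h' := congrFun h ⟨i / a % m, Nat.mod_lt _ hm⟩
  have hidx : i % a + a * (m * (i / a / m) + i / a % m) = i := by
    rw [Nat.div_add_mod, Nat.mod_add_div]
  simp only [miniWord, hUS, hTj, ← ha, hidx] at h'
  rw [dif_pos hi, dif_pos hi, hib] at h'
  exact h'

end Decoding

/-! ### Generic channels and coefficients. -/

section Channel

variable {K L : ℕ}

/-- In the common kernel `P` of the rows in `D`, each row `i ∉ D` vanishes only on a proper
subspace, since a functional separating it from the span is the dot product with a vector of `P`. At
most `K < q` proper subspaces do not cover `P`. -/
lemma exists_zeroForcing_vector {𝔽 : Type} [Field 𝔽] [Finite 𝔽] (hq : K < Nat.card 𝔽)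
    (H : Matrix (Fin K) (Fin L) 𝔽) (D : Finset (Fin K))
    (h : ∀ i ∉ D, H i ∉ Submodule.span 𝔽 (Set.range fun j : D => H j)) :
    ∃ v, (∀ j ∈ D, H j ⬝ᵥ v = 0) ∧ ∀ i ∉ D, H i ⬝ᵥ v ≠ 0 := by
  classical
  let P : Submodule 𝔽 (Fin L → 𝔽) :=
    LinearMap.ker (Matrix.mulVecLin (Matrix.of fun j : D => H j))
  have hP : ∀ v, v ∈ P ↔ ∀ j ∈ D, H j ⬝ᵥ v = 0 := fun v => by
    simp only [P, LinearMap.mem_ker, Matrix.mulVecLin_apply, funext_iff, Subtype.forall]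
    rfl
  let p : {i // i ∉ D} → Submodule 𝔽 P := fun i =>
    LinearMap.ker ((LinearMap.proj i.1 ∘ₗ Matrix.mulVecLin H).domRestrict P)
  have hp : ∀ i (v : P), v ∈ p i ↔ H i.1 ⬝ᵥ v.1 = 0 := fun i v => Iff.rfl
  have htop : ∀ i, p i ≠ ⊤ := by
    intro i hi
    obtain ⟨f, hf1, hf2⟩ := Submodule.exists_le_ker_of_notMem (h i.1 i.2)
    have hf : ∀ x, f x = x ⬝ᵥ fun l => f (fun j => if l = j then 1 else 0) := fun x => by
      rw [LinearMap.pi_apply_eq_sum_univ f x]; rfl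
    have hw : (fun l => f (fun j => if l = j then 1 else 0)) ∈ P := (hP _).2 fun j hj => by
      rw [← hf]
      exact hf2 (Submodule.subset_span ⟨⟨j, hj⟩, rfl⟩)
    have := (hp i ⟨_, hw⟩).1 (hi ▸ Submodule.mem_top)
    rw [← hf] at this
    exact hf1 this
  have hcard : ((Finset.univ : Finset {i // i ∉ D}).card : ℕ∞) < ENat.card 𝔽 := by
    rw [ENat.card_eq_coe_natCard]
    refine Nat.cast_lt.2 (lt_of_le_of_lt ?_ hq)
    simp
  have hlt := Submodule.iUnion_ssubset_of_forall_ne_top_of_card_lt Finset.univ p htop hcard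
  obtain ⟨v, -, hv⟩ := Set.exists_of_ssubset hlt
  refine ⟨v.1, (hP _).1 v.2, fun i hi h0 => hv ?_⟩
  exact Set.mem_iUnion₂.2 ⟨⟨i, hi⟩, Finset.mem_univ _, (hp ⟨i, hi⟩ v).2 h0⟩

lemma exists_isZeroForcing {𝔽 : Type} [Field 𝔽] [Finite 𝔽] (hL : 1 ≤ L) (hq : K < Nat.card 𝔽)
    (H : Matrix (Fin K) (Fin L) 𝔽)
    (h : ∀ D : Finset (Fin K), D.card < L → ∀ i ∉ D,
      H i ∉ Submodule.span 𝔽 (Set.range fun j : D => H j)) :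
    ∃ ψ, IsZeroForcing H ψ := by
  have hD : ∀ D : Finset (Fin K), ∃ v, D.card < L →
      (∀ j ∈ D, H j ⬝ᵥ v = 0) ∧ ∀ i ∉ D, H i ⬝ᵥ v ≠ 0 := by
    intro D
    by_cases hc : D.card < L
    · obtain ⟨v, hv⟩ := exists_zeroForcing_vector hq H D (h D hc)
      exact ⟨v, fun _ => hv⟩
    -- The value `0` is never used: the sets `T \ U` have `t - α ≤ L - 1` elements.
    · exact ⟨0, fun hc' => absurd hc' hc⟩
  choose ψ hψ using hD
  refine ⟨ψ, fun α T U hU => ?_⟩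
  obtain ⟨h1, h2⟩ := Finset.mem_powersetCard.1 hU
  have hc : (T.1 \ U).card < L := by
    rw [Finset.card_sdiff_of_subset h1, T.2, h2]
    have : groupSize K L α ≤ α + L - 1 := min_le_left _ _
    omega
  refine ⟨(hψ _ hc).1, fun i hi => (hψ _ hc).2 i fun hi' => (Finset.mem_sdiff.1 hi').2 hi⟩

/-- Deleting `k` is injective on these sets. For a group, the bound is `numRepeats`, so a user has
no more unknowns than equations. -/
lemma card_servedWith_le {α : ℕ} {T : Finset (Fin K)} {k : Fin K} (hk : k ∈ T) :
    (servedWith α T k).card ≤ (T.card - 1).choose (α - 1) := by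
  rw [← Finset.card_erase_of_mem hk, ← Finset.card_powersetCard]
  refine Finset.card_le_card_of_injOn (fun U => U.erase k) ?_ ?_
  · intro U hU
    obtain ⟨h1, h2⟩ := mem_servedWith.1 hU
    obtain ⟨h3, h4⟩ := Finset.mem_powersetCard.1 h1
    exact Finset.mem_powersetCard.2
      ⟨Finset.erase_subset_erase k h3, by rw [Finset.card_erase_of_mem h2, h4]⟩
  · intro U hU V hV h
    rw [← Finset.insert_erase (mem_servedWith.1 hU).2, ← Finset.insert_erase (mem_servedWith.1 hV).2]
    exact congrArg (insert k) h

lemma isGeneric_of_notMem_span {𝔽 : Type} [Field 𝔽] {φ : Coefficients 𝔽 K L}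
    (h : ∀ (α : Order K) (T : Group K L α) (k : Fin K), ∀ U ∈ servedWith α.1 T.1 k,
      (fun ω => φ α T ω U k) ∉ Submodule.span 𝔽
        (Set.range fun (V : (servedWith α.1 T.1 k).erase U) ω => φ α T ω V.1 k)) :
    IsGeneric φ := by
  intro α T k
  rw [linearIndependent_iff_notMem_span]
  rintro ⟨U, hU⟩ hmem
  refine h α T k U hU (Submodule.span_mono ?_ hmem)
  rintro _ ⟨⟨V, hV⟩, hne, rfl⟩
  refine ⟨⟨V, Finset.mem_erase.2 ⟨fun hVU => hne.2 (Subtype.ext hVU), hV⟩⟩, rfl⟩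

variable {𝔽 : Type} [Field 𝔽] [Finite 𝔽]

/-- Resample row `i`, which leaves the fewer than `L` rows in `D` unchanged. The side conditions are
put inside the event so that the union bound can run over all pairs `(D, i)`; when they fail the
event is empty. -/
lemma uniformProb_channel_mem_span_le (D : Finset (Fin K)) (i : Fin K) :
    uniformProb {x : Matrix (Fin K) (Fin L) 𝔽 × Coefficients 𝔽 K L | D.card < L ∧ i ∉ D ∧
      x.1 i ∈ Submodule.span 𝔽 (Set.range fun j : D => x.1 j)} ≤ 1 / Nat.card 𝔽 := by
  classical
  by_cases h : D.card < L ∧ i ∉ D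
  · refine (uniformProb_mono fun x hx => hx.2.2).trans (uniformProb_mem_span_le
      (Ω := Matrix (Fin K) (Fin L) 𝔽 × Coefficients 𝔽 K L)
      (fun x v => ((Function.update x.1 i v : Fin K → Fin L → 𝔽), x.2)) (fun x => x.1 i)
      ?_ ?_ ?_ (fun x (j : D) => x.1 j) ?_ ?_)
    · intro x v w
      exact Prod.ext (Function.update_idem _ _ _) rfl
    · intro x v
      exact Function.update_self _ _ _
    · intro x
      exact Prod.ext (Function.update_eq_self _ _) rfl
    · intro x v
      funext j
      have hj : j.1 ≠ i := fun hj => h.2 (hj ▸ j.2)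
      exact Function.update_of_ne hj _ _
    · simpa using h.1
  · have : {x : Matrix (Fin K) (Fin L) 𝔽 × Coefficients 𝔽 K L | D.card < L ∧ i ∉ D ∧
      x.1 i ∈ Submodule.span 𝔽 (Set.range fun j : D => x.1 j)} = ∅ :=
      Set.eq_empty_of_forall_notMem fun x hx => h ⟨hx.1, hx.2.1⟩
    rw [this, uniformProb_eq_card_div]
    simp

lemma uniformProb_coefficients_mem_span_le (α : Order K) (T : Group K L α) (k : Fin K)
    (U : Finset (Fin K)) :
    uniformProb {x : Matrix (Fin K) (Fin L) 𝔽 × Coefficients 𝔽 K L | U ∈ servedWith α.1 T.1 k ∧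
      (fun ω => x.2 α T ω U k) ∈ Submodule.span 𝔽
        (Set.range fun (V : (servedWith α.1 T.1 k).erase U) ω => x.2 α T ω V.1 k)} ≤
      1 / Nat.card 𝔽 := by
  classical
  by_cases h : U ∈ servedWith α.1 T.1 k
  · refine (uniformProb_mono fun x hx => hx.2).trans (uniformProb_mem_span_le
      (Ω := Matrix (Fin K) (Fin L) 𝔽 × Coefficients 𝔽 K L)
      (fun x v => (x.1, Function.update x.2 α (Function.update (x.2 α) T fun ω =>
        Function.update (x.2 α T ω) U (Function.update (x.2 α T ω U) k (v ω)))))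
      (fun x ω => x.2 α T ω U k) ?_ ?_ ?_
      (fun x (V : (servedWith α.1 T.1 k).erase U) ω => x.2 α T ω V.1 k) ?_ ?_)
    · intro x v w
      simp
    · intro x v
      simp
    · intro x
      simp
    · intro x v
      funext V ω
      have := (Finset.mem_erase.1 V.2).1
      simp [this]
    · obtain ⟨h1, h2⟩ := mem_servedWith.1 h
      have hk := (Finset.mem_powersetCard.1 h1).1 h2
      have h3 := card_servedWith_le (α := α.1) hk
      rw [T.2] at h3
      rw [Fintype.card_coe, Finset.card_erase_of_mem h, Fintype.card_fin, numRepeats]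
      have := Finset.card_pos.2 ⟨U, h⟩
      omega
  · rw [show {x : Matrix (Fin K) (Fin L) 𝔽 × Coefficients 𝔽 K L | U ∈ servedWith α.1 T.1 k ∧
      (fun ω => x.2 α T ω U k) ∈ Submodule.span 𝔽
        (Set.range fun (V : (servedWith α.1 T.1 k).erase U) ω => x.2 α T ω V.1 k)} = ∅ from
      Set.eq_empty_of_forall_notMem fun x hx => h hx.1, uniformProb_eq_card_div]
    simp

/-- The number of events which are excluded in `le_uniformProb_good`. -/
def numExceptions (K L : ℕ) : ℕ :=
  Fintype.card ((Finset (Fin K) × Fin K) ⊕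
    (Σ α : Order K, Group K L α × Fin K × Finset (Fin K)))

lemma le_uniformProb_good (hL : 1 ≤ L) (hq : K < Nat.card 𝔽) :
    1 - numExceptions K L * (1 / Nat.card 𝔽 : ℝ) ≤
      uniformProb {x : Matrix (Fin K) (Fin L) 𝔽 × Coefficients 𝔽 K L |
        (∃ ψ, IsZeroForcing x.1 ψ) ∧ IsGeneric x.2} := by
  refine one_sub_le_uniformProb (B := Sum.elim
    (fun y => {x | y.1.card < L ∧ y.2 ∉ y.1 ∧
      x.1 y.2 ∈ Submodule.span 𝔽 (Set.range fun j : y.1 => x.1 j)})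
    (fun y => {x | y.2.2.2 ∈ servedWith y.1.1 y.2.1.1 y.2.2.1 ∧
      (fun ω => x.2 y.1 y.2.1 ω y.2.2.2 y.2.2.1) ∈ Submodule.span 𝔽
        (Set.range fun (V : (servedWith y.1.1 y.2.1.1 y.2.2.1).erase y.2.2.2) ω =>
          x.2 y.1 y.2.1 ω V.1 y.2.2.1)})) ?_ ?_
  · rintro (⟨D, i⟩ | ⟨α, T, k, U⟩)
    · exact uniformProb_channel_mem_span_le D i
    · exact uniformProb_coefficients_mem_span_le α T k U
  · intro x hx
    refine ⟨exists_isZeroForcing hL hq x.1 fun D hD i hi hmem => ?_,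
      isGeneric_of_notMem_span fun α T k U hU hmem => ?_⟩
    · exact hx (Sum.inl (D, i)) ⟨hD, hi, hmem⟩
    · exact hx (Sum.inr ⟨α, T, k, U⟩) ⟨hU, hmem⟩

end Channel

/-- For `L = 1` the last factor of each summand is `1`, and the summands are `(1 - p) / p` times the
binomial probabilities with `α ≥ 1`; these add up to `1 - (1 - p) ^ K`. -/
lemma delay_one {K N : ℕ} {M : ℝ} (hN : 1 ≤ N) (hM : 0 < M) :
    delay K 1 N M = K * (1 - M / N) * ((N : ℝ) / (K * M)) * (1 - (1 - M / N) ^ K) := by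
  rcases Nat.eq_zero_or_pos K with rfl | hK
  · simp [delay]
  have hNr : (0 : ℝ) < N := by exact_mod_cast hN
  have hKr : (0 : ℝ) < K := by exact_mod_cast hK
  set p := M / N with hp
  have hp0 : 0 < p := by positivity
  have hR : K * (1 - p) * ((N : ℝ) / (K * M)) * (1 - (1 - p) ^ K) =
      (1 - p) / p * (1 - (1 - p) ^ K) := by
    rw [hp]; field_simp
  have hterm : ∀ α ∈ Finset.Icc 1 K, (K.choose α : ℝ) * p ^ (α - 1) * (1 - p) ^ (K - α + 1) *
      ((α : ℝ) / (min (α + 1 - 1) K : ℕ)) =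
      (1 - p) / p * (p ^ α * (1 - p) ^ (K - α) * K.choose α) := by
    intro α hα
    obtain ⟨h1, h2⟩ := Finset.mem_Icc.1 hα
    have hα0 : (α : ℝ) ≠ 0 := by exact_mod_cast (by omega : α ≠ 0)
    obtain ⟨β, rfl⟩ : ∃ β, α = β + 1 := ⟨α - 1, by omega⟩
    rw [Nat.add_sub_cancel, Nat.add_sub_cancel, min_eq_left h2, div_self hα0, pow_succ, pow_succ]
    field_simp
  have hbin := add_pow p (1 - p) K
  rw [add_sub_cancel, one_pow, Finset.range_eq_Ico, Finset.sum_eq_sum_Ico_succ_bot (by omega)]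
    at hbin
  rw [hR, delay, Finset.sum_congr rfl hterm, ← Finset.mul_sum]
  congr 1
  have hI : Finset.Icc 1 K = Finset.Ico (0 + 1) (K + 1) := by ext; simp
  rw [hI]
  simp only [pow_zero, Nat.sub_zero, Nat.choose_zero_right, Nat.cast_one, one_mul, mul_one] at hbin
  linarith

end CodedCaching

theorem corollary1 (K L : ℕ) (hL : 1 ≤ L) :
    (∀ δ : ℝ, 0 < δ → ∃ m₀ : ℕ, ∀ m : ℕ, m₀ ≤ m →
      ∀ (𝔽 : Type) [Field 𝔽] [Finite 𝔽] (e : (Fin m → Bool) ≃ 𝔽)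
        (N : ℕ) (M : ℝ), 1 ≤ N → 0 ≤ M → M ≤ N →
        1 - δ ≤ CodedCaching.uniformProb
          {x : Matrix (Fin K) (Fin L) 𝔽 × CodedCaching.Coefficients 𝔽 K L |
            (∃ ψ, CodedCaching.IsZeroForcing x.1 ψ) ∧
            ∀ ψ, CodedCaching.IsZeroForcing x.1 ψ →
              CodedCaching.Achieves N M e x.1 x.2 ψ (CodedCaching.delay K L N M)}) ∧
    (L = 1 → ∀ (N : ℕ) (M : ℝ), 1 ≤ N → 0 < M → M ≤ N →
      CodedCaching.delay K L N M =
        K * (1 - M / N) * ((N : ℝ) / (K * M)) * (1 - (1 - M / N) ^ K)) := by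
  -- Since `q = 2 ^ m > m`, the first summand gives `q > K` for zero-forcing, the second brings the
  -- union bound below `δ`, and the `1` ensures `m > 0`.
  refine ⟨fun δ hδ => ⟨K + ⌈(CodedCaching.numExceptions K L : ℝ) / δ⌉₊ + 1, ?_⟩, ?_⟩
  · intro m hm 𝔽 _ _ e N M hN hM0 hM
    have hcard : Nat.card 𝔽 = 2 ^ m := by
      rw [← Nat.card_congr e]; simp
    have hlt : m < 2 ^ m := Nat.lt_two_pow_self
    have hq : K < Nat.card 𝔽 := by omega
    refine le_trans ?_ ((CodedCaching.le_uniformProb_good (K := K) (L := L) hL hq).trans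
      (CodedCaching.uniformProb_mono ?_))
    · have h1 : (CodedCaching.numExceptions K L : ℝ) / δ ≤ Nat.card 𝔽 := by
        refine (Nat.le_ceil _).trans ?_
        rw [hcard]
        exact_mod_cast (by omega : ⌈(CodedCaching.numExceptions K L : ℝ) / δ⌉₊ ≤ 2 ^ m)
      have hq0 : (0 : ℝ) < Nat.card 𝔽 := by exact_mod_cast (by omega : 0 < Nat.card 𝔽)
      rw [div_le_iff₀ hδ] at h1
      have h2 : (CodedCaching.numExceptions K L : ℝ) * (1 / Nat.card 𝔽) ≤ δ := by
        rw [mul_one_div, div_le_iff₀ hq0]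
        linarith
      linarith
    · rintro ⟨H, φ⟩ ⟨hH, hφ⟩
      refine ⟨hH, fun ψ hψ => ?_⟩
      have hm0 : 0 < m := by omega
      exact CodedCaching.achieves_of_allDecode hm0 hL hN hM0 hM e H φ ψ
        fun F c Z => CodedCaching.allDecode hm0 hL e hφ hψ Z
  · rintro rfl N M hN hM0 _
    exact CodedCaching.delay_one hN hM0
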